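/- Let $N\ge 4$, $\kappa>0$. A \emph{seed} is an orthogonal-symmetric vacuum metric $$\hat g=\epsilon e^{2V(x)}dy^2+e^{-2V(x)}\hat h_{ij}(x)\,dx^i dx^j,\qquad \epsilon=\pm1,$$ on a coordinate domain $\{(y,x):y\in J,\ x\in\Omega\}$ ($J\subset\mathbb R$, $\Omega\subset\mathbb R^{N-1}$ open and non-empty, $V$ and the metric $\hat h$ smooth), satisfying $R_{\mu\nu}[\hat g]=\frac{2}{N-2}\Lambda\,\hat g_{\mu\nu}$. Given real parameters $\alpha,\delta,\sigma,\rho,k,W_0$ and a function $\mu(y)$, the solution transformation assigns to the seed the metric, scalar field and potential $$g=e^{2\mu(y)}\left(\epsilon e^{2\alpha V}dy^2+e^{-2\alpha V}e^{-2\delta V}\hat h_{ij}dx^idx^j\right),\quad \phi=\sigma V(x)+\rho\,\mu(y),\quad W[\phi]=W_0e^{-2k\phi},$$ where $\delta=\frac{N-4}{N-3}(1-\alpha)$, $\sigma^2=\frac{N-2}{\kappa(N-3)}(1-\alpha^2)$, $k=\frac{\kappa\rho}{N-2}$ if $W_0\ne0$, and $\rho\neq0$ if $\Lambda\ne0$.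 Let $\mathcal S_N$ be the class of those $(g,\phi,W)$ with $\mu=0$, obtained in this way from some seed, that solve the minimally coupled Einstein-scalar field equations $$R_{\mu\nu}[g]=\kappa\left(\nabla_\mu\phi\nabla_\nu\phi+\tfrac{2}{N-2}g_{\mu\nu}W[\phi]\right),\qquad \Box\phi-W'[\phi]=0,$$ and let $\mathcal S_N^\Lambda$ be the subclass derived from seeds with $\Lambda\neq0$. Then: (1) $\mathcal S_N^\Lambda$ is empty: no orthogonal-symmetric ($\mu=0$) scalar field solution is derived by the transformation from a vacuum solution with $\Lambda\ne0$. (2) $W_0=0$ for the entire class $\mathcal S_N$; that is, no solution of class $\mathcal S_N$ has a potential term ($W\equiv0$). (3) If the scalar field $\phi$ is not constant, then $\Lambda=0$ and $W_0=0$ hold for every transformed configuration with $\mu=0$ that solves the field equations, as soon as $\delta=\frac{N-4}{N-3}(1-\alpha)$, with no other condition on $\alpha,\sigma,\rho,k,W_0$. -/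

import Mathlib

/-! Coordinate geometry on open subsets of `ℝ^m`, the Einstein-scalar field equations, and the
transformation of orthogonal-symmetric vacuum metrics into conformally y-inflated
Einstein-scalar field configurations. -/

noncomputable section

namespace EinsteinScalar

/-! ### Curvature of a metric given by its components -/

/-- The partial derivative `∂_i f` at `z`. -/
def pd {m : ℕ} (i : Fin m) (f : (Fin m → ℝ) → ℝ) (z : Fin m → ℝ) : ℝ :=
  fderiv ℝ f z (Pi.single i 1)

/-- A (0,2)-tensor field on (part of) `ℝ^m`, given by its matrix of components. -/
abbrev TensorField (m : ℕ) : Type := (Fin m → ℝ) → Matrix (Fin m) (Fin m) ℝ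

/-- Christoffel symbols
`Γ^k_{ij} = (1/2) g^{kl} (∂_i g_{jl} + ∂_j g_{il} - ∂_l g_{ij})`. -/
def christoffel {m : ℕ} (g : TensorField m) (k i j : Fin m) (z : Fin m → ℝ) : ℝ :=
  (1 / 2) * ∑ l, (g z)⁻¹ k l *
    (pd i (fun w => g w j l) z + pd j (fun w => g w i l) z - pd l (fun w => g w i j) z)

/-- The Ricci tensor
`R_{ij} = ∂_k Γ^k_{ij} - ∂_j Γ^k_{ik} + Γ^k_{kl} Γ^l_{ij} - Γ^k_{jl} Γ^l_{ik}`. -/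
def ricci {m : ℕ} (g : TensorField m) (i j : Fin m) (z : Fin m → ℝ) : ℝ :=
  (∑ k, pd k (christoffel g k i j) z) - (∑ k, pd j (christoffel g k i k) z)
    + (∑ k, ∑ l, christoffel g k k l z * christoffel g l i j z)
    - ∑ k, ∑ l, christoffel g k j l z * christoffel g l i k z

/-- The Laplace (d'Alembert) operator `□f = g^{ij} (∂_i ∂_j f - Γ^k_{ij} ∂_k f)`. -/
def box {m : ℕ} (g : TensorField m) (f : (Fin m → ℝ) → ℝ) (z : Fin m → ℝ) : ℝ :=
  ∑ i, ∑ j, (g z)⁻¹ i j *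
    (pd i (fun w => pd j f w) z - ∑ k, christoffel g k i j z * pd k f z)

/-! ### Field equations

The space-time dimension is `N = n + 1`; the coordinates are `z = (y, x)` with
`y = z 0` and `x = Fin.tail z ∈ ℝ^n`. -/

/-- The space-time dimension `N = n + 1`, as a real number. -/
abbrev dimN (n : ℕ) : ℝ := (n : ℝ) + 1

/-- A metric, a scalar field and a scalar field potential on a coordinate domain. -/
structure FieldConfig (n : ℕ) where
  /-- the coordinate domain -/
  dom : Set (Fin (n + 1) → ℝ)
  /-- the space-time metric -/
  g : TensorField (n + 1)
  /-- the scalar field -/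
  φ : (Fin (n + 1) → ℝ) → ℝ
  /-- the (effective) scalar field potential, a function of the scalar field value -/
  W : ℝ → ℝ

/-- The minimally coupled Einstein-scalar field equations
`R_{ij} = κ (∂_i φ ∂_j φ + 2/(N-2) g_{ij} W(φ))` and `□φ - W'(φ) = 0`. -/
def FieldConfig.IsSolution {n : ℕ} (κ : ℝ) (c : FieldConfig n) : Prop :=
  ∀ z ∈ c.dom,
    (∀ i j, ricci c.g i j z =
      κ * (pd i c.φ z * pd j c.φ z + 2 / (dimN n - 2) * c.g z i j * c.W (c.φ z))) ∧
    box c.g c.φ z - deriv c.W (c.φ z) = 0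

/-! ### Orthogonal-symmetric metrics and seeds -/

/-- The orthogonal-symmetric metric
`g[U, h] = ε e^{2U(x)} dy² + e^{-2U(x)} h_{ij}(x) dx^i dx^j`. -/
def orthMetric {n : ℕ} (ε : ℝ) (U : (Fin n → ℝ) → ℝ) (h : TensorField n) :
    TensorField (n + 1) := fun z =>
  Matrix.of (Fin.cons
    (Fin.cons (ε * Real.exp (2 * U (Fin.tail z))) (fun _ => 0))
    (fun i => Fin.cons 0
      (fun j => Real.exp (-2 * U (Fin.tail z)) * h (Fin.tail z) i j)))

/-- The coordinate domain `{(y, x) | y ∈ J, x ∈ Ω}`. -/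
def cylinder {n : ℕ} (J : Set ℝ) (Ω : Set (Fin n → ℝ)) : Set (Fin (n + 1) → ℝ) :=
  {z | z 0 ∈ J ∧ Fin.tail z ∈ Ω}

/-- An orthogonal-symmetric vacuum solution `g[V, h]` in dimension `N = n + 1` with
cosmological constant `Λ`: `R_{ij} = 2/(N-2) Λ g_{ij}`. The metric may have any signature. -/
structure Seed (n : ℕ) where
  /-- the sign of the Killing direction -/
  ε : ℝ
  /-- the cosmological constant -/
  Λ : ℝ
  /-- the range of the coordinate `y` along the Killing direction -/
  J : Set ℝ
  /-- the domain of the remaining coordinates `x` -/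
  Ω : Set (Fin n → ℝ)
  /-- the metric function -/
  V : (Fin n → ℝ) → ℝ
  /-- the metric `ĥ` in the remaining coordinates -/
  h : TensorField n
  ε_sign : ε = -1 ∨ ε = 1
  J_open : IsOpen J
  J_nonempty : J.Nonempty
  Ω_open : IsOpen Ω
  Ω_nonempty : Ω.Nonempty
  V_smooth : ContDiffOn ℝ (⊤ : ℕ∞) V Ω
  h_smooth : ∀ i j, ContDiffOn ℝ (⊤ : ℕ∞) (fun x => h x i j) Ω
  h_symm : ∀ x ∈ Ω, (h x).IsSymm
  h_nondeg : ∀ x ∈ Ω, (h x).det ≠ 0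
  vacuum : ∀ z ∈ cylinder J Ω, ∀ i j,
    ricci (orthMetric ε V h) i j z = 2 / (dimN n - 2) * orthMetric ε V h z i j * Λ

/-! ### The solution transformation -/

/-- The parameters of the transformation. -/
structure Params where
  α : ℝ
  δ : ℝ
  σ : ℝ
  ρ : ℝ
  k : ℝ
  W₀ : ℝ

/-- The transformed configuration: the metric
`e^{2μ(y)} (ε e^{2αV} dy² + e^{-2αV} e^{-2δV} ĥ_{ij} dx^i dx^j)`, the scalar field
`φ = σ V(x) + ρ μ(y)` and the potential `W(φ) = W₀ e^{-2kφ}`. -/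
def Seed.transform {n : ℕ} (s : Seed n) (p : Params) (μ : ℝ → ℝ) : FieldConfig n where
  dom := cylinder s.J s.Ω
  g := fun z => Real.exp (2 * μ (z 0)) •
    orthMetric s.ε (fun x => p.α * s.V x)
      (fun x => Real.exp (-2 * (p.δ * s.V x)) • s.h x) z
  φ := fun z => p.σ * s.V (Fin.tail z) + p.ρ * μ (z 0)
  W := fun t => p.W₀ * Real.exp (-2 * p.k * t)

/-- `δ = (N-4)/(N-3) (1-α)`. -/
def Params.DeltaRule (n : ℕ) (p : Params) : Prop :=
  p.δ = (dimN n - 4) / (dimN n - 3) * (1 - p.α)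

/-- `σ² = (N-2)/(κ(N-3)) (1-α²)`. -/
def Params.SigmaRule (n : ℕ) (κ : ℝ) (p : Params) : Prop :=
  p.σ ^ 2 = (dimN n - 2) / (κ * (dimN n - 3)) * (1 - p.α ^ 2)

/-- The parametric constraints of the transformation that do not involve the function `μ`:
the two rules above, `k = κρ/(N-2)` for a non-zero potential, and `ρ ≠ 0` for a seed with
`Λ ≠ 0` (for which the transformation involves the quotient `σ/ρ`). -/
structure Params.Admissible (n : ℕ) (κ Λ : ℝ) (p : Params) : Prop where
  delta_rule : p.DeltaRule n
  sigma_rule : p.SigmaRule n κ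
  k_rule : p.W₀ ≠ 0 → p.k = κ * p.ρ / (dimN n - 2)
  rho_ne_zero : Λ ≠ 0 → p.ρ ≠ 0

/-- The orthogonal-symmetric (`μ = 0`) Einstein-scalar field solutions which the transformation
derives from orthogonal-symmetric vacuum solutions with cosmological constant `Λ`. -/
def classSOf (n : ℕ) (κ Λ : ℝ) : Set (FieldConfig n) :=
  {c | ∃ (s : Seed n) (p : Params), s.Λ = Λ ∧ p.Admissible n κ Λ ∧
    c = s.transform p 0 ∧ c.IsSolution κ}

/-- The class `S_N^Λ`: derived from seeds with non-zero cosmological constant. -/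
def classSLambda (n : ℕ) (κ : ℝ) : Set (FieldConfig n) :=
  {c | ∃ Λ : ℝ, Λ ≠ 0 ∧ c ∈ classSOf n κ Λ}

/-- The class `S_N`: derived from seeds with arbitrary cosmological constant. -/
def classS (n : ℕ) (κ : ℝ) : Set (FieldConfig n) :=
  {c | ∃ Λ : ℝ, c ∈ classSOf n κ Λ}

end EinsteinScalar

end

noncomputable section

namespace EinsteinScalar

/-! The seed and the transformed metric at `μ = 0` both belong to the family `scaledMetric` with
exponents `(a, b)`: the seed has `(1, 1)`, the transform `(α, α + δ)`. The rule for `δ` puts both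
pairs on the line `a - (n - 2) b = 3 - n`. On this line the `dy²` component of the Ricci tensor is
an explicit factor times one expression `reducedBox` free of `a` and `b`, and in the spatial
components the Ricci tensor of `h` and the Hessian of `V` have coefficients free of `a` and `b`
(`ricci_zero_zero`, `ricci_succ_succ`).

Comparing the `dy²` equations gives `κ W = α Λ e^{2(α+δ-1)V}`, so `Λ = 0` forces `W₀ = 0`.
Subtracting the spatial equations leaves a scalar times `h_ij` equal to a multiple of `∂_i V ∂_j V`.
As `h` is nondegenerate in dimension at least two, the scalar vanishes, so `Λ (2 - α - (α + δ)) = 0`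
(`lambda_relations`).

If `Λ ≠ 0`, then `α = 1` and `δ = 0` (`rigidity`). Under the full constraints `σ = 0`, so `φ = 0`
while `W₀ ≠ 0`; the scalar equation gives `k = 0`, hence `ρ = 0`, which is excluded. Under the `δ`
rule alone, the spatial equations give `σ ∂V = 0`; a nonconstant `φ` has `σ ≠ 0`, so `∂V = 0`, and
then the seed equation yields `Λ = 0`. -/

/-! ### Calculus of partial derivatives and smoothness of the geometric quantities. -/

theorem pd_congr {m : ℕ} {f g : (Fin m → ℝ) → ℝ} {x : Fin m → ℝ} (h : f =ᶠ[nhds x] g)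
    (i : Fin m) : pd i f x = pd i g x := by
  simp only [pd, h.fderiv_eq]

theorem pd_const {m : ℕ} (i : Fin m) (c : ℝ) (x : Fin m → ℝ) : pd i (fun _ => c) x = 0 := by
  simp [pd]

theorem pd_add {m : ℕ} {f g : (Fin m → ℝ) → ℝ} {x : Fin m → ℝ} (hf : DifferentiableAt ℝ f x)
    (hg : DifferentiableAt ℝ g x) (i : Fin m) :
    pd i (fun w => f w + g w) x = pd i f x + pd i g x := by
  simp [pd, fderiv_fun_add hf hg]

theorem pd_sub {m : ℕ} {f g : (Fin m → ℝ) → ℝ} {x : Fin m → ℝ} (hf : DifferentiableAt ℝ f x)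
    (hg : DifferentiableAt ℝ g x) (i : Fin m) :
    pd i (fun w => f w - g w) x = pd i f x - pd i g x := by
  simp [pd, fderiv_fun_sub hf hg]

theorem pd_mul {m : ℕ} {f g : (Fin m → ℝ) → ℝ} {x : Fin m → ℝ} (hf : DifferentiableAt ℝ f x)
    (hg : DifferentiableAt ℝ g x) (i : Fin m) :
    pd i (fun w => f w * g w) x = pd i f x * g x + f x * pd i g x := by
  simp [pd, fderiv_fun_mul hf hg]; ring

theorem pd_const_mul {m : ℕ} {f : (Fin m → ℝ) → ℝ} {x : Fin m → ℝ} (hf : DifferentiableAt ℝ f x)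
    (c : ℝ) (i : Fin m) : pd i (fun w => c * f w) x = c * pd i f x := by
  rw [pd_mul (differentiableAt_const c) hf, pd_const]; ring

theorem pd_exp {m : ℕ} {f : (Fin m → ℝ) → ℝ} {x : Fin m → ℝ} (hf : DifferentiableAt ℝ f x)
    (i : Fin m) : pd i (fun w => Real.exp (f w)) x = pd i f x * Real.exp (f x) := by
  simp [pd, fderiv_exp hf]; ring

theorem pd_sum {m : ℕ} {ι : Type*} (s : Finset ι) {f : ι → (Fin m → ℝ) → ℝ} {x : Fin m → ℝ}
    (hf : ∀ k ∈ s, DifferentiableAt ℝ (f k) x) (i : Fin m) :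
    pd i (fun w => ∑ k ∈ s, f k w) x = ∑ k ∈ s, pd i (f k) x := by
  simp [pd, fderiv_fun_sum hf]

/-- Deletion of the first coordinate as a continuous linear map. -/
def tailCLM (n : ℕ) : (Fin (n + 1) → ℝ) →L[ℝ] (Fin n → ℝ) :=
  ContinuousLinearMap.pi fun i => ContinuousLinearMap.proj i.succ

theorem tailCLM_apply {n : ℕ} (z : Fin (n + 1) → ℝ) : tailCLM n z = Fin.tail z := rfl

theorem continuous_tail {n : ℕ} : Continuous (Fin.tail : (Fin (n + 1) → ℝ) → (Fin n → ℝ)) :=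
  (tailCLM n).continuous

theorem fderiv_comp_tail {n : ℕ} {f : (Fin n → ℝ) → ℝ} {z : Fin (n + 1) → ℝ}
    (hf : DifferentiableAt ℝ f (Fin.tail z)) :
    fderiv ℝ (fun w => f (Fin.tail w)) z = (fderiv ℝ f (Fin.tail z)).comp (tailCLM n) := by
  have h := fderiv_comp (f := tailCLM n) (g := f) z hf (tailCLM n).differentiableAt
  rwa [ContinuousLinearMap.fderiv] at h

theorem pd_zero_comp_tail {n : ℕ} {f : (Fin n → ℝ) → ℝ} {z : Fin (n + 1) → ℝ}
    (hf : DifferentiableAt ℝ f (Fin.tail z)) : pd 0 (fun w => f (Fin.tail w)) z = 0 := by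
  rw [pd, fderiv_comp_tail hf, ContinuousLinearMap.comp_apply, tailCLM_apply]
  have : (Fin.tail (Pi.single (0 : Fin (n + 1)) (1 : ℝ) : Fin (n + 1) → ℝ) : Fin n → ℝ) = 0 := by
    ext j; simp [Fin.tail]
  rw [this, map_zero]

theorem pd_succ_comp_tail {n : ℕ} {f : (Fin n → ℝ) → ℝ} {z : Fin (n + 1) → ℝ}
    (hf : DifferentiableAt ℝ f (Fin.tail z)) (i : Fin n) :
    pd i.succ (fun w => f (Fin.tail w)) z = pd i f (Fin.tail z) := by
  rw [pd, fderiv_comp_tail hf, ContinuousLinearMap.comp_apply, tailCLM_apply, pd]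
  congr 1
  ext j
  simp [Fin.tail, Pi.single_apply]

theorem contDiffAt_pd {m : ℕ} {f : (Fin m → ℝ) → ℝ} {x : Fin m → ℝ}
    (hf : ContDiffAt ℝ (⊤ : ℕ∞) f x) (i : Fin m) : ContDiffAt ℝ (⊤ : ℕ∞) (pd i f) x :=
  (hf.fderiv_right (m := (⊤ : ℕ∞)) le_rfl).clm_apply contDiffAt_const

theorem pd_comm {m : ℕ} {f : (Fin m → ℝ) → ℝ} {x : Fin m → ℝ}
    (hf : ContDiffAt ℝ (⊤ : ℕ∞) f x) (i j : Fin m) :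
    pd i (pd j f) x = pd j (pd i f) x := by
  have hd : DifferentiableAt ℝ (fderiv ℝ f) x :=
    (hf.fderiv_right (m := (⊤ : ℕ∞)) le_rfl).differentiableAt (by simp)
  have key : ∀ i j : Fin m, pd i (pd j f) x =
      fderiv ℝ (fderiv ℝ f) x (Pi.single i 1) (Pi.single j 1) := by
    intro i j
    unfold pd
    rw [fderiv_clm_apply hd (differentiableAt_const _)]
    simp
  rw [key, key]
  exact (hf.isSymmSndFDerivAt (by simp only [minSmoothness_of_isRCLikeNormedField]; exact WithTop.coe_le_coe.2 (le_top : (2 : ℕ∞) ≤ ⊤))).eq _ _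

theorem contDiffAt_det {m : ℕ} {E : Type*} [NormedAddCommGroup E] [NormedSpace ℝ E]
    {h : E → Matrix (Fin m) (Fin m) ℝ} {x : E}
    (hh : ∀ i j, ContDiffAt ℝ (⊤ : ℕ∞) (fun w => h w i j) x) :
    ContDiffAt ℝ (⊤ : ℕ∞) (fun w => (h w).det) x := by
  simp only [Matrix.det_apply']
  exact ContDiffAt.sum fun σ _ => contDiffAt_const.mul (contDiffAt_prod fun i _ => hh _ _)

theorem contDiffAt_inv_apply {m : ℕ} {h : TensorField m} {x : Fin m → ℝ}
    (hh : ∀ i j, ContDiffAt ℝ (⊤ : ℕ∞) (fun w => h w i j) x) (hx : (h x).det ≠ 0)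
    (i j : Fin m) : ContDiffAt ℝ (⊤ : ℕ∞) (fun w => (h w)⁻¹ i j) x := by
  simp only [Matrix.inv_def, Matrix.smul_apply, smul_eq_mul, Ring.inverse_eq_inv']
  refine ((contDiffAt_det hh).inv hx).mul ?_
  simp only [Matrix.adjugate_apply]
  refine contDiffAt_det fun k l => ?_
  simp only [Matrix.updateRow_apply]
  split_ifs
  · exact contDiffAt_const
  · exact hh k l

theorem contDiffAt_christoffel {m : ℕ} {h : TensorField m} {x : Fin m → ℝ}
    (hh : ∀ i j, ContDiffAt ℝ (⊤ : ℕ∞) (fun w => h w i j) x) (hx : (h x).det ≠ 0)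
    (k i j : Fin m) : ContDiffAt ℝ (⊤ : ℕ∞) (christoffel h k i j) x := by
  unfold christoffel
  exact contDiffAt_const.mul (ContDiffAt.sum fun l _ => (contDiffAt_inv_apply hh hx k l).mul
    (((contDiffAt_pd (hh j l) i).add (contDiffAt_pd (hh i l) j)).sub (contDiffAt_pd (hh i j) l)))

/-! ### The two-parameter family of metrics and its inverse. -/

/-- A smooth function and a smooth non-degenerate symmetric tensor field on an open set. -/
structure SmoothData {n : ℕ} (Ω : Set (Fin n → ℝ)) (V : (Fin n → ℝ) → ℝ)
    (h : TensorField n) : Prop where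
  isOpen : IsOpen Ω
  V_smooth : ContDiffOn ℝ (⊤ : ℕ∞) V Ω
  h_smooth : ∀ i j, ContDiffOn ℝ (⊤ : ℕ∞) (fun x => h x i j) Ω
  h_symm : ∀ x ∈ Ω, (h x).IsSymm
  h_nondeg : ∀ x ∈ Ω, (h x).det ≠ 0

theorem Seed.smoothData {n : ℕ} (s : Seed n) : SmoothData s.Ω s.V s.h :=
  ⟨s.Ω_open, s.V_smooth, s.h_smooth, s.h_symm, s.h_nondeg⟩

/-- The metric `ε e^{2aV} dy² + e^{-2bV} h_{ij} dx^i dx^j`. -/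
def scaledMetric {n : ℕ} (ε : ℝ) (V : (Fin n → ℝ) → ℝ) (h : TensorField n) (a b : ℝ) :
    TensorField (n + 1) := fun z =>
  Matrix.of (Fin.cons
    (Fin.cons (ε * Real.exp (2 * a * V (Fin.tail z))) (fun _ => 0))
    (fun i => Fin.cons 0
      (fun j => Real.exp (-(2 * b) * V (Fin.tail z)) * h (Fin.tail z) i j)))

/-- The gradient `V^k = h^{kl} ∂_l V`. -/
def grad {n : ℕ} (V : (Fin n → ℝ) → ℝ) (h : TensorField n) (k : Fin n) (x : Fin n → ℝ) : ℝ :=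
  ∑ l, (h x)⁻¹ k l * pd l V x

/-- The divergence form `∂_k V^k + Γ^k_{kl} V^l - (n-3) V_k V^k` of the equation for `V`. -/
def reducedBox {n : ℕ} (V : (Fin n → ℝ) → ℝ) (h : TensorField n)
    (x : Fin n → ℝ) : ℝ :=
  ∑ k, pd k (grad V h k) x + ∑ l, (∑ k, christoffel h k k l x) * grad V h l x
    - (n - 3) * ∑ k, pd k V x * grad V h k x

section entries
variable {n : ℕ} (ε : ℝ) (V : (Fin n → ℝ) → ℝ) (h : TensorField n) (a b : ℝ)
  (z : Fin (n + 1) → ℝ)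

theorem scaledMetric_zero_zero :
    scaledMetric ε V h a b z 0 0 = ε * Real.exp (2 * a * V (Fin.tail z)) := rfl

theorem scaledMetric_zero_succ (j : Fin n) : scaledMetric ε V h a b z 0 j.succ = 0 := rfl

theorem scaledMetric_succ_zero (i : Fin n) : scaledMetric ε V h a b z i.succ 0 = 0 := rfl

theorem scaledMetric_succ_succ (i j : Fin n) : scaledMetric ε V h a b z i.succ j.succ =
    Real.exp (-(2 * b) * V (Fin.tail z)) * h (Fin.tail z) i j := rfl

variable {ε h z} in
-- The block form is stable under inversion: `ε` is its own inverse and the exponents change sign.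
theorem scaledMetric_inv (hε : ε * ε = 1) (hz : (h (Fin.tail z)).det ≠ 0) :
    (scaledMetric ε V h a b z)⁻¹ = scaledMetric ε V (fun x => (h x)⁻¹) (-a) (-b) z := by
  refine Matrix.inv_eq_right_inv ?_
  have hh : h (Fin.tail z) * (h (Fin.tail z))⁻¹ = 1 :=
    Matrix.mul_nonsing_inv _ (isUnit_iff_ne_zero.2 hz)
  ext i j
  rw [Matrix.mul_apply, Fin.sum_univ_succ]
  refine Fin.cases ?_ (fun i => ?_) i <;> refine Fin.cases ?_ (fun j => ?_) j
  · simp only [scaledMetric_zero_zero, scaledMetric_zero_succ, zero_mul, Finset.sum_const_zero,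
      Matrix.one_apply_eq, add_zero]
    rw [mul_mul_mul_comm, hε, ← Real.exp_add]
    ring_nf
    simp
  · simp [scaledMetric_zero_succ, (Fin.succ_ne_zero _).symm]
  · simp [scaledMetric_succ_zero]
  · simp only [scaledMetric_succ_zero, scaledMetric_succ_succ, zero_mul, zero_add]
    have : ∀ k, Real.exp (-(2 * b) * V (Fin.tail z)) * h (Fin.tail z) i k *
        (Real.exp (-(2 * -b) * V (Fin.tail z)) * (h (Fin.tail z))⁻¹ k j) =
        h (Fin.tail z) i k * (h (Fin.tail z))⁻¹ k j := by
      intro k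
      rw [mul_mul_mul_comm, ← Real.exp_add]
      ring_nf
      simp
    rw [Finset.sum_congr rfl fun k _ => this k, ← Matrix.mul_apply, hh]
    simp [Matrix.one_apply]

end entries

/-! ### Index identities for `h`, its Christoffel symbols and the gradient of `V`. -/

namespace SmoothData
variable {n : ℕ} {Ω : Set (Fin n → ℝ)} {V : (Fin n → ℝ) → ℝ} {h : TensorField n}
  (D : SmoothData Ω V h) {x : Fin n → ℝ} (hx : x ∈ Ω)
include D hx

theorem V_at : ContDiffAt ℝ (⊤ : ℕ∞) V x := D.V_smooth.contDiffAt (D.isOpen.mem_nhds hx)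

theorem h_at (i j : Fin n) : ContDiffAt ℝ (⊤ : ℕ∞) (fun w => h w i j) x :=
  (D.h_smooth i j).contDiffAt (D.isOpen.mem_nhds hx)

theorem grad_at (k : Fin n) : ContDiffAt ℝ (⊤ : ℕ∞) (grad V h k) x :=
  ContDiffAt.sum fun l _ => (contDiffAt_inv_apply (D.h_at hx) (D.h_nondeg x hx) k l).mul
    (contDiffAt_pd (D.V_at hx) l)

theorem christoffel_at (k i j : Fin n) : ContDiffAt ℝ (⊤ : ℕ∞) (christoffel h k i j) x :=
  contDiffAt_christoffel (D.h_at hx) (D.h_nondeg x hx) k i j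

theorem pd_h_symm (k i j : Fin n) :
    pd k (fun w => h w i j) x = pd k (fun w => h w j i) x :=
  pd_congr (Filter.eventually_of_mem (D.isOpen.mem_nhds hx) fun w hw => (D.h_symm w hw).apply j i)
    k

theorem sum_inv_mul (k j : Fin n) : ∑ l, (h x)⁻¹ k l * h x j l = if k = j then 1 else 0 := by
  have hh : (h x)⁻¹ * h x = 1 := Matrix.nonsing_inv_mul _ (isUnit_iff_ne_zero.2 (D.h_nondeg x hx))
  rw [← Matrix.one_apply, ← hh, Matrix.mul_apply]
  exact Finset.sum_congr rfl fun l _ => by rw [(D.h_symm x hx).apply]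

theorem sum_mul_inv (i j : Fin n) : ∑ k, h x i k * (h x)⁻¹ k j = if i = j then 1 else 0 := by
  have hh : h x * (h x)⁻¹ = 1 := Matrix.mul_nonsing_inv _ (isUnit_iff_ne_zero.2 (D.h_nondeg x hx))
  rw [← Matrix.one_apply, ← hh, Matrix.mul_apply]

theorem sum_mul_grad (i : Fin n) : ∑ k, h x i k * grad V h k x = pd i V x := by
  simp only [grad, Finset.mul_sum]
  rw [Finset.sum_comm]
  simp only [← mul_assoc, ← Finset.sum_mul, D.sum_mul_inv hx]
  simp

/-- Lowering the first index of the Christoffel symbols. -/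
theorem sum_mul_christoffel (l i j : Fin n) : ∑ k, h x l k * christoffel h k i j x =
    (1 / 2) * (pd i (fun w => h w j l) x + pd j (fun w => h w i l) x
      - pd l (fun w => h w i j) x) := by
  simp only [christoffel, Finset.mul_sum]
  rw [Finset.sum_comm]
  have : ∀ m k : Fin n, h x l k * (1 / 2 * ((h x)⁻¹ k m * (pd i (fun w => h w j m) x +
      pd j (fun w => h w i m) x - pd m (fun w => h w i j) x))) =
      (h x l k * (h x)⁻¹ k m) * (1 / 2 * (pd i (fun w => h w j m) x +
      pd j (fun w => h w i m) x - pd m (fun w => h w i j) x)) := fun m k => by ring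
  simp only [this, ← Finset.sum_mul, D.sum_mul_inv hx]
  simp

/-- The covariant derivative of `h` vanishes. -/
theorem pd_h_eq (k i j : Fin n) : pd k (fun w => h w i j) x =
    ∑ l, h x j l * christoffel h l i k x + ∑ l, h x i l * christoffel h l j k x := by
  rw [D.sum_mul_christoffel hx, D.sum_mul_christoffel hx, D.pd_h_symm hx k j i,
    D.pd_h_symm hx i j k, D.pd_h_symm hx j i k]
  ring

theorem christoffel_symm (k i j : Fin n) : christoffel h k i j x = christoffel h k j i x := by
  unfold christoffel
  congr 1
  refine Finset.sum_congr rfl fun l _ => ?_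
  rw [D.pd_h_symm hx l i j]
  ring

end SmoothData

/-! ### Derivatives of the components and Christoffel symbols of the family. -/

namespace SmoothData
variable {n : ℕ} {Ω : Set (Fin n → ℝ)} {V : (Fin n → ℝ) → ℝ} {h : TensorField n}
  (D : SmoothData Ω V h) {z : Fin (n + 1) → ℝ} (hz : Fin.tail z ∈ Ω) {ε : ℝ} (a b : ℝ)
include D hz

omit hz in
theorem pd_exp_mul {f : (Fin n → ℝ) → ℝ} {x : Fin n → ℝ} (hx : x ∈ Ω)
    (hf : DifferentiableAt ℝ f x) (c : ℝ) (i : Fin n) :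
    pd i (fun w => Real.exp (c * V w) * f w) x =
      Real.exp (c * V x) * (pd i f x + c * pd i V x * f x) := by
  have hV := (D.V_at hx).differentiableAt (by simp)
  rw [pd_mul (by fun_prop) hf, pd_exp (by fun_prop), pd_const_mul hV]
  ring

theorem pd_zero_scaledMetric (A B : Fin (n + 1)) :
    pd 0 (fun w => scaledMetric ε V h a b w A B) z = 0 := by
  have hV := (D.V_at hz).differentiableAt (by simp)
  refine Fin.cases ?_ (fun i => ?_) A <;> refine Fin.cases ?_ (fun j => ?_) B
  · exact pd_zero_comp_tail (f := fun x => ε * Real.exp (2 * a * V x)) (by fun_prop)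
  · exact pd_const _ _ _
  · exact pd_const _ _ _
  · have := (D.h_at hz i j).differentiableAt (by simp)
    exact pd_zero_comp_tail (f := fun x => Real.exp (-(2 * b) * V x) * h x i j) (by fun_prop)

theorem pd_succ_scaledMetric_zero_zero (k : Fin n) :
    pd k.succ (fun w => scaledMetric ε V h a b w 0 0) z =
      2 * a * ε * Real.exp (2 * a * V (Fin.tail z)) * pd k V (Fin.tail z) := by
  have hV := (D.V_at hz).differentiableAt (by simp)
  refine (pd_succ_comp_tail (f := fun x => ε * Real.exp (2 * a * V x)) (by fun_prop) k).trans ?_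
  rw [pd_const_mul (by fun_prop), pd_exp (by fun_prop), pd_const_mul hV]
  ring

theorem pd_succ_scaledMetric_succ_succ (k i j : Fin n) :
    pd k.succ (fun w => scaledMetric ε V h a b w i.succ j.succ) z =
      Real.exp (-(2 * b) * V (Fin.tail z)) * (pd k (fun w => h w i j) (Fin.tail z)
        - 2 * b * pd k V (Fin.tail z) * h (Fin.tail z) i j) := by
  have hV := (D.V_at hz).differentiableAt (by simp)
  have hd := (D.h_at hz i j).differentiableAt (by simp)
  refine (pd_succ_comp_tail (f := fun x => Real.exp (-(2 * b) * V x) * h x i j)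
    (by fun_prop) k).trans ?_
  rw [D.pd_exp_mul hz hd]
  ring

omit D hz in
theorem pd_scaledMetric_zero_succ (A : Fin (n + 1)) (j : Fin n) :
    pd A (fun w => scaledMetric ε V h a b w 0 j.succ) z = 0 := pd_const _ _ _

omit D hz in
theorem pd_scaledMetric_succ_zero (A : Fin (n + 1)) (j : Fin n) :
    pd A (fun w => scaledMetric ε V h a b w j.succ 0) z = 0 := pd_const _ _ _

end SmoothData
namespace SmoothData
variable {n : ℕ} {Ω : Set (Fin n → ℝ)} {V : (Fin n → ℝ) → ℝ} {h : TensorField n}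
  (D : SmoothData Ω V h) {z : Fin (n + 1) → ℝ} (hz : Fin.tail z ∈ Ω) {ε : ℝ} (hε : ε * ε = 1)
  (a b : ℝ)
include D hz hε

theorem christoffel_zero_eq (A B : Fin (n + 1)) :
    christoffel (scaledMetric ε V h a b) 0 A B z = (1 / 2) *
      (ε * Real.exp (-(2 * a) * V (Fin.tail z)) *
        (pd A (fun w => scaledMetric ε V h a b w B 0) z +
          pd B (fun w => scaledMetric ε V h a b w A 0) z)) := by
  unfold christoffel
  rw [Fin.sum_univ_succ, scaledMetric_inv V a b hε (D.h_nondeg _ hz), D.pd_zero_scaledMetric hz]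
  simp [scaledMetric_zero_zero, scaledMetric_zero_succ]

theorem christoffel_succ_eq (k : Fin n) (A B : Fin (n + 1)) :
    christoffel (scaledMetric ε V h a b) k.succ A B z = (1 / 2) * ∑ l,
      Real.exp (2 * b * V (Fin.tail z)) * (h (Fin.tail z))⁻¹ k l *
        (pd A (fun w => scaledMetric ε V h a b w B l.succ) z +
          pd B (fun w => scaledMetric ε V h a b w A l.succ) z -
          pd l.succ (fun w => scaledMetric ε V h a b w A B) z) := by
  unfold christoffel
  rw [Fin.sum_univ_succ, scaledMetric_inv V a b hε (D.h_nondeg _ hz)]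
  simp [scaledMetric_succ_zero, scaledMetric_succ_succ]

theorem christoffel_zero_zero_zero :
    christoffel (scaledMetric ε V h a b) 0 0 0 z = 0 := by
  rw [D.christoffel_zero_eq hz hε, D.pd_zero_scaledMetric hz]
  simp

theorem christoffel_zero_zero_succ (i : Fin n) :
    christoffel (scaledMetric ε V h a b) 0 0 i.succ z = a * pd i V (Fin.tail z) := by
  rw [D.christoffel_zero_eq hz hε, D.pd_zero_scaledMetric hz, D.pd_succ_scaledMetric_zero_zero hz]
  have : Real.exp (-(2 * a) * V (Fin.tail z)) * Real.exp (2 * a * V (Fin.tail z)) = 1 := by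
    rw [← Real.exp_add]; ring_nf; simp
  linear_combination (a * pd i V (Fin.tail z)) * (hε + ε * ε * this)

theorem christoffel_zero_succ_zero (i : Fin n) :
    christoffel (scaledMetric ε V h a b) 0 i.succ 0 z = a * pd i V (Fin.tail z) := by
  rw [← D.christoffel_zero_zero_succ hz hε a b, D.christoffel_zero_eq hz hε,
    D.christoffel_zero_eq hz hε]
  ring

theorem christoffel_zero_succ_succ (i j : Fin n) :
    christoffel (scaledMetric ε V h a b) 0 i.succ j.succ z = 0 := by
  rw [D.christoffel_zero_eq hz hε, pd_scaledMetric_succ_zero, pd_scaledMetric_succ_zero]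
  simp

theorem christoffel_succ_zero_zero (k : Fin n) :
    christoffel (scaledMetric ε V h a b) k.succ 0 0 z =
      -(ε * a) * (Real.exp (2 * (a + b) * V (Fin.tail z)) * grad V h k (Fin.tail z)) := by
  rw [D.christoffel_succ_eq hz hε, grad, Finset.mul_sum, Finset.mul_sum, Finset.mul_sum]
  refine Finset.sum_congr rfl fun l _ => ?_
  rw [pd_scaledMetric_zero_succ, D.pd_succ_scaledMetric_zero_zero hz]
  have : Real.exp (2 * (a + b) * V (Fin.tail z)) =
      Real.exp (2 * a * V (Fin.tail z)) * Real.exp (2 * b * V (Fin.tail z)) := by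
    rw [← Real.exp_add]; ring_nf
  rw [this]
  ring

theorem christoffel_succ_zero_succ (k i : Fin n) :
    christoffel (scaledMetric ε V h a b) k.succ 0 i.succ z = 0 := by
  rw [D.christoffel_succ_eq hz hε]
  simp [D.pd_zero_scaledMetric hz, pd_scaledMetric_zero_succ]

theorem christoffel_succ_succ_zero (k i : Fin n) :
    christoffel (scaledMetric ε V h a b) k.succ i.succ 0 z = 0 := by
  rw [D.christoffel_succ_eq hz hε]
  simp [D.pd_zero_scaledMetric hz, pd_scaledMetric_zero_succ, pd_scaledMetric_succ_zero]

/-- The spatial block is conformal to `h` with factor `e^{-2bV}`, so this is the classical conformal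
change formula. -/
theorem christoffel_succ_succ_succ (k i j : Fin n) :
    christoffel (scaledMetric ε V h a b) k.succ i.succ j.succ z =
      christoffel h k i j (Fin.tail z) - b * ((if k = j then 1 else 0) * pd i V (Fin.tail z) +
        (if k = i then 1 else 0) * pd j V (Fin.tail z) -
        h (Fin.tail z) i j * grad V h k (Fin.tail z)) := by
  rw [D.christoffel_succ_eq hz hε, ← D.sum_inv_mul hz k j, ← D.sum_inv_mul hz k i, grad,
    christoffel]
  simp only [Finset.mul_sum, Finset.sum_mul, ← Finset.sum_add_distrib, ← Finset.sum_sub_distrib]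
  refine Finset.sum_congr rfl fun l _ => ?_
  simp only [D.pd_succ_scaledMetric_succ_succ hz]
  have : Real.exp (2 * b * V (Fin.tail z)) * Real.exp (-(2 * b) * V (Fin.tail z)) = 1 := by
    rw [← Real.exp_add]; ring_nf; simp
  set x := Fin.tail z
  linear_combination (1 / 2 * (h x)⁻¹ k l * (pd i (fun w => h w j l) x -
      2 * b * pd i V x * h x j l + (pd j (fun w => h w i l) x - 2 * b * pd j V x * h x i l)
      - (pd l (fun w => h w i j) x - 2 * b * pd l V x * h x i j))) * this

end SmoothData
-- Algebra of the conformal correction to the Christoffel symbols.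
section sums
variable {n : ℕ} (H : Fin n → Fin n → Fin n → ℝ) (v w : Fin n → ℝ) (g : Fin n → Fin n → ℝ)

/-- Contraction of the change of the Christoffel symbols under a conformal change. -/
theorem sum_conformal_diag (hgw : ∀ i, ∑ k, g i k * w k = v i) (i : Fin n) :
    ∑ k, ((if k = k then 1 else 0) * v i + (if k = i then 1 else 0) * v k - g i k * w k) =
      n * v i := by
  simp [Finset.sum_add_distrib, Finset.sum_sub_distrib, hgw]

theorem sum_mul_conformal (t : Fin n → ℝ) (i j : Fin n) :
    ∑ l, t l * ((if l = j then 1 else 0) * v i + (if l = i then 1 else 0) * v j - g i j * w l) =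
      t j * v i + t i * v j - g i j * ∑ l, t l * w l := by
  simp only [mul_sub, mul_add, Finset.sum_sub_distrib, Finset.sum_add_distrib,
    mul_left_comm _ (g i j), ← Finset.mul_sum]
  simp

theorem sum_sum_conformal_mul (i j : Fin n) :
    ∑ k, ∑ l, ((if k = l then 1 else 0) * v j + (if k = j then 1 else 0) * v l - g j l * w k) *
      H l i k = ∑ l, v l * H l i j + v j * ∑ k, H k i k - ∑ l, g j l * ∑ k, H l i k * w k := by
  have h1 : ∀ k l : Fin n, ((if k = l then 1 else 0) * v j + (if k = j then 1 else 0) * v l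
      - g j l * w k) * H l i k = (if k = l then v j * H l i k else 0) +
        (if k = j then v l * H l i k else 0) - g j l * (H l i k * w k) := by
    intro k l
    split_ifs <;> ring
  simp only [h1, Finset.sum_add_distrib, Finset.sum_sub_distrib]
  rw [Finset.sum_comm (f := fun k l => g j l * (H l i k * w k)),
    Finset.sum_comm (f := fun k l => if k = j then v l * H l i k else 0)]
  simp only [Finset.sum_ite_eq, Finset.sum_ite_eq', Finset.mem_univ, if_true, ← Finset.mul_sum]
  ring

theorem sum_sum_conformal_conformal (hg : ∀ i j, g i j = g j i)
    (hgw : ∀ i, ∑ k, g i k * w k = v i) (i j : Fin n) :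
    ∑ k, ∑ l, ((if k = l then 1 else 0) * v j + (if k = j then 1 else 0) * v l - g j l * w k) *
      ((if l = k then 1 else 0) * v i + (if l = i then 1 else 0) * v k - g i k * w l) =
      (n + 2) * (v i * v j) - 2 * g i j * ∑ k, v k * w k := by
  rw [sum_sum_conformal_mul (fun l i k =>
    (if l = k then 1 else 0) * v i + (if l = i then 1 else 0) * v k - g i k * w l),
    sum_conformal_diag v w g hgw, sum_mul_conformal v w g v i j]
  have h1 : ∀ l, ∑ k, ((if l = k then 1 else 0) * v i + (if l = i then 1 else 0) * v k
      - g i k * w l) * w k = (if l = i then 1 else 0) * ∑ k, v k * w k := by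
    intro l
    simp only [sub_mul, add_mul, Finset.sum_sub_distrib, Finset.sum_add_distrib,
      mul_right_comm _ (w l) (w _), ← Finset.sum_mul, hgw]
    simp [Finset.sum_ite_eq, Finset.mul_sum, mul_comm]
  simp only [h1]
  simp only [ite_mul, one_mul, zero_mul, mul_ite, mul_zero, Finset.sum_ite_eq', Finset.mem_univ,
    if_true, hg j i]
  ring

/-- This expands the `ΓΓ` term of the Ricci tensor in powers of `b`, with `v` and `w` in the roles
of `V_i` and `V^i`. -/
theorem sum_sum_sub_mul_sub (hg : ∀ i j, g i j = g j i) (hgw : ∀ i, ∑ k, g i k * w k = v i)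
    (b : ℝ) (i j : Fin n) :
    ∑ k, ∑ l, (H k j l - b * ((if k = l then 1 else 0) * v j + (if k = j then 1 else 0) * v l
        - g j l * w k)) *
      (H l i k - b * ((if l = k then 1 else 0) * v i + (if l = i then 1 else 0) * v k
        - g i k * w l)) =
      ∑ k, ∑ l, H k j l * H l i k
        - b * (∑ l, v l * H l i j + v j * ∑ k, H k i k - ∑ l, g j l * ∑ k, H l i k * w k)
        - b * (∑ l, v l * H l j i + v i * ∑ k, H k j k - ∑ l, g i l * ∑ k, H l j k * w k)
        + b ^ 2 * ((n + 2) * (v i * v j) - 2 * g i j * ∑ k, v k * w k) := by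
  -- The two cross terms are the same contraction with `i` and `j` exchanged, once the summation
  -- indices are swapped.
  rw [← sum_sum_conformal_conformal v w g hg hgw i j, ← sum_sum_conformal_mul H v w g i j,
    ← sum_sum_conformal_mul H v w g j i,
    Finset.sum_comm (f := fun k l => ((if k = l then (1 : ℝ) else 0) * v i +
      (if k = i then 1 else 0) * v l - g i l * w k) * H l j k)]
  simp only [Finset.mul_sum, ← Finset.sum_sub_distrib, ← Finset.sum_add_distrib]
  refine Finset.sum_congr rfl fun k _ => Finset.sum_congr rfl fun l _ => ?_
  ring

end sums

/-! ### The Ricci tensor of the family. -/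

namespace SmoothData
variable {n : ℕ} {Ω : Set (Fin n → ℝ)} {V : (Fin n → ℝ) → ℝ} {h : TensorField n}
  (D : SmoothData Ω V h) {z : Fin (n + 1) → ℝ} (hz : Fin.tail z ∈ Ω) {ε : ℝ} (hε : ε * ε = 1)
  (a b : ℝ)
include D hz

theorem eventually_tail_mem : ∀ᶠ w in nhds z, (Fin.tail w : Fin n → ℝ) ∈ Ω :=
  (D.isOpen.preimage continuous_tail).mem_nhds hz

theorem pd_christoffel_eq_zero {K A B : Fin (n + 1)} (C : Fin (n + 1))
    (H : ∀ w : Fin (n + 1) → ℝ, Fin.tail w ∈ Ω →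
      christoffel (scaledMetric ε V h a b) K A B w = 0) :
    pd C (christoffel (scaledMetric ε V h a b) K A B) z = 0 := by
  rw [pd_congr ((D.eventually_tail_mem hz).mono H), pd_const]

include hε

theorem pd_succ_christoffel_succ_zero_zero (k m : Fin n) :
    pd m.succ (christoffel (scaledMetric ε V h a b) k.succ 0 0) z =
      -(ε * a) * (Real.exp (2 * (a + b) * V (Fin.tail z)) * (pd m (grad V h k) (Fin.tail z) +
        2 * (a + b) * pd m V (Fin.tail z) * grad V h k (Fin.tail z))) := by
  have hV := (D.V_at hz).differentiableAt (by simp)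
  have hg := (D.grad_at hz k).differentiableAt (by simp)
  rw [pd_congr ((D.eventually_tail_mem hz).mono fun w hw =>
    D.christoffel_succ_zero_zero hw hε a b k)]
  refine (pd_succ_comp_tail (f := fun x => -(ε * a) *
    (Real.exp (2 * (a + b) * V x) * grad V h k x)) (by fun_prop) m).trans ?_
  rw [pd_const_mul (by fun_prop), D.pd_exp_mul hz hg]

theorem pd_succ_christoffel_zero_succ_zero (i m : Fin n) :
    pd m.succ (christoffel (scaledMetric ε V h a b) 0 i.succ 0) z =
      a * pd m (pd i V) (Fin.tail z) := by
  have hV := (contDiffAt_pd (D.V_at hz) i).differentiableAt (by simp)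
  rw [pd_congr ((D.eventually_tail_mem hz).mono fun w hw =>
    D.christoffel_zero_succ_zero hw hε a b i)]
  refine (pd_succ_comp_tail (f := fun x => a * pd i V x) (by fun_prop) m).trans ?_
  rw [pd_const_mul hV]

theorem pd_succ_christoffel_succ_succ_succ (m k i j : Fin n) :
    pd m.succ (christoffel (scaledMetric ε V h a b) k.succ i.succ j.succ) z =
      pd m (christoffel h k i j) (Fin.tail z) -
      b * ((if k = j then 1 else 0) * pd m (pd i V) (Fin.tail z) +
        (if k = i then 1 else 0) * pd m (pd j V) (Fin.tail z) -
        (pd m (fun w => h w i j) (Fin.tail z) * grad V h k (Fin.tail z) +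
          h (Fin.tail z) i j * pd m (grad V h k) (Fin.tail z))) := by
  have hi := (contDiffAt_pd (D.V_at hz) i).differentiableAt (by simp)
  have hj := (contDiffAt_pd (D.V_at hz) j).differentiableAt (by simp)
  have hg := (D.grad_at hz k).differentiableAt (by simp)
  have hh := (D.h_at hz i j).differentiableAt (by simp)
  have hc := (D.christoffel_at hz k i j).differentiableAt (by simp)
  rw [pd_congr ((D.eventually_tail_mem hz).mono fun w hw =>
    D.christoffel_succ_succ_succ hw hε a b k i j)]
  refine (pd_succ_comp_tail (f := fun x => christoffel h k i j x -
    b * ((if k = j then 1 else 0) * pd i V x + (if k = i then 1 else 0) * pd j V x -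
      h x i j * grad V h k x)) (by fun_prop) m).trans ?_
  rw [pd_sub hc (by fun_prop), pd_const_mul (by fun_prop), pd_sub (by fun_prop) (by fun_prop),
    pd_add (by fun_prop) (by fun_prop), pd_const_mul hi, pd_const_mul hj, pd_mul hh hg]

theorem sum_christoffel_trace (i : Fin n) :
    ∑ k : Fin n, christoffel (scaledMetric ε V h a b) k.succ i.succ k.succ z =
      ∑ k, christoffel h k i k (Fin.tail z) - b * (n * pd i V (Fin.tail z)) := by
  rw [← sum_conformal_diag (fun i => pd i V (Fin.tail z)) (fun k => grad V h k (Fin.tail z))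
    (fun i j => h (Fin.tail z) i j) (fun i => D.sum_mul_grad hz i) i, Finset.mul_sum,
    ← Finset.sum_sub_distrib]
  exact Finset.sum_congr rfl fun k _ => D.christoffel_succ_succ_succ hz hε a b k i k

theorem sum_christoffel_trace' (l : Fin n) :
    ∑ k : Fin n, christoffel (scaledMetric ε V h a b) k.succ k.succ l.succ z =
      ∑ k, christoffel h k k l (Fin.tail z) - b * (n * pd l V (Fin.tail z)) := by
  have h1 : ∀ k : Fin n, christoffel (scaledMetric ε V h a b) k.succ k.succ l.succ z =
      christoffel (scaledMetric ε V h a b) k.succ l.succ k.succ z := by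
    intro k
    rw [D.christoffel_succ_succ_succ hz hε, D.christoffel_succ_succ_succ hz hε,
      D.christoffel_symm hz, (D.h_symm _ hz).apply]
    ring
  simp only [h1, D.sum_christoffel_trace hz hε, D.christoffel_symm hz _ l]

/-- For general exponents `V_k V^k` enters with coefficient `2(a + b) + (a - bn) - 2a = a - (n -
2)b`. The hypothesis `hab` fixes it to `3 - n`, which makes the bracket independent of `a` and `b`.
-/
theorem ricci_zero_zero (hab : a - (n - 2) * b = 3 - n) :
    ricci (scaledMetric ε V h a b) 0 0 z =
      -(ε * a) * (Real.exp (2 * (a + b) * V (Fin.tail z)) * reducedBox V h (Fin.tail z)) := by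
  unfold ricci
  have e1 : ∑ k, pd k (christoffel (scaledMetric ε V h a b) k 0 0) z =
      -(ε * a) * (Real.exp (2 * (a + b) * V (Fin.tail z)) *
        (∑ k, pd k (grad V h k) (Fin.tail z) + 2 * (a + b) *
          ∑ k, pd k V (Fin.tail z) * grad V h k (Fin.tail z))) := by
    rw [Fin.sum_univ_succ, D.pd_christoffel_eq_zero hz a b _
      (fun w hw => D.christoffel_zero_zero_zero hw hε a b)]
    simp only [D.pd_succ_christoffel_succ_zero_zero hz hε, Finset.mul_sum, zero_add,
      ← Finset.sum_add_distrib]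
    exact Finset.sum_congr rfl fun k _ => by ring
  have e2 : ∑ k, pd 0 (christoffel (scaledMetric ε V h a b) k 0 k) z = 0 := by
    rw [Fin.sum_univ_succ, D.pd_christoffel_eq_zero hz a b _
      (fun w hw => D.christoffel_zero_zero_zero hw hε a b),
      Finset.sum_congr rfl fun (k : Fin n) _ => D.pd_christoffel_eq_zero hz a b _
      (fun w hw => D.christoffel_succ_zero_succ hw hε a b k k)]
    simp
  have e3 : ∑ k, ∑ l, christoffel (scaledMetric ε V h a b) k k l z *
      christoffel (scaledMetric ε V h a b) l 0 0 z = -(ε * a) *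
      (Real.exp (2 * (a + b) * V (Fin.tail z)) *
        (∑ l, (∑ k, christoffel h k k l (Fin.tail z)) * grad V h l (Fin.tail z) + (a - b * n) *
          ∑ k, pd k V (Fin.tail z) * grad V h k (Fin.tail z))) := by
    rw [Finset.sum_comm]
    simp only [← Finset.sum_mul]
    rw [Fin.sum_univ_succ, D.christoffel_zero_zero_zero hz hε, mul_zero, zero_add]
    simp only [Fin.sum_univ_succ (f := fun k => christoffel (scaledMetric ε V h a b) k k _ z),
      D.christoffel_zero_zero_succ hz hε, D.sum_christoffel_trace' hz hε,
      D.christoffel_succ_zero_zero hz hε, Finset.mul_sum, ← Finset.sum_add_distrib]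
    exact Finset.sum_congr rfl fun k _ => by ring
  have e4 : ∑ k, ∑ l, christoffel (scaledMetric ε V h a b) k 0 l z *
      christoffel (scaledMetric ε V h a b) l 0 k z = -(ε * a) *
      (Real.exp (2 * (a + b) * V (Fin.tail z)) * (2 * a *
          ∑ k, pd k V (Fin.tail z) * grad V h k (Fin.tail z))) := by
    simp only [Fin.sum_univ_succ, D.christoffel_zero_zero_zero hz hε,
      D.christoffel_zero_zero_succ hz hε, D.christoffel_succ_zero_zero hz hε,
      D.christoffel_succ_zero_succ hz hε, mul_zero, zero_add, Finset.sum_const_zero, add_zero,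
      Finset.mul_sum, ← Finset.sum_add_distrib]
    exact Finset.sum_congr rfl fun k _ => by ring
  rw [e1, e2, e3, e4, reducedBox]
  linear_combination (-(ε * a) * (Real.exp (2 * (a + b) * V (Fin.tail z)) *
    ∑ k, pd k V (Fin.tail z) * grad V h k (Fin.tail z))) * hab

omit hε in
-- Differentiate `h_ik V^k = V_i`, which holds throughout `Ω`.
theorem sum_pd_mul_grad (i j : Fin n) : ∑ k, (pd j (fun w => h w i k) (Fin.tail z) *
    grad V h k (Fin.tail z) + h (Fin.tail z) i k * pd j (grad V h k) (Fin.tail z)) =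
      pd j (pd i V) (Fin.tail z) := by
  have hg := fun k => (D.grad_at hz k).differentiableAt (by simp)
  have hh := fun k => (D.h_at hz i k).differentiableAt (by simp)
  rw [pd_congr (Filter.eventually_of_mem (D.isOpen.mem_nhds hz)
    fun w hw => (D.sum_mul_grad hw i).symm), pd_sum _ fun k _ => (hh k).fun_mul (hg k)]
  exact Finset.sum_congr rfl fun k _ => (pd_mul (hh k) (hg k) j).symm

/-- The Hessian of `V` arises with coefficient `(n - 2)b - a`, which `hab` fixes to `n - 3`; the
multiples of `h_ij` assemble into `b` times `reducedBox`. The exponents survive only in the last two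
terms. -/
theorem ricci_succ_succ (hab : a - (n - 2) * b = 3 - n) (i j : Fin n) :
    ricci (scaledMetric ε V h a b) i.succ j.succ z =
      ricci h i j (Fin.tail z) + (n - 3) * (pd j (pd i V) (Fin.tail z)
        - ∑ l, pd l V (Fin.tail z) * christoffel h l i j (Fin.tail z))
      + ((n - 2) * b ^ 2 - 2 * a * b - a ^ 2) * (pd i V (Fin.tail z) * pd j V (Fin.tail z))
      + b * h (Fin.tail z) i j * reducedBox V h (Fin.tail z) := by
  have e1 : ∑ k, pd k (christoffel (scaledMetric ε V h a b) k i.succ j.succ) z =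
      ∑ k, pd k (christoffel h k i j) (Fin.tail z) - b * (2 * pd j (pd i V) (Fin.tail z)
        - ∑ k, pd k (fun w => h w i j) (Fin.tail z) * grad V h k (Fin.tail z)
        - h (Fin.tail z) i j * ∑ k, pd k (grad V h k) (Fin.tail z)) := by
    rw [Fin.sum_univ_succ, D.pd_christoffel_eq_zero hz a b _
      (fun w hw => D.christoffel_zero_succ_succ hw hε a b i j)]
    simp only [D.pd_succ_christoffel_succ_succ_succ hz hε, Finset.sum_sub_distrib,
      ← Finset.mul_sum, Finset.sum_add_distrib, ite_mul, one_mul, zero_mul, Finset.sum_ite_eq',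
      Finset.mem_univ, if_true, pd_comm (D.V_at hz) i j]
    ring
  have e2 : ∑ k, pd j.succ (christoffel (scaledMetric ε V h a b) k i.succ k) z =
      ∑ k, pd j (christoffel h k i k) (Fin.tail z) + (a - b * n) * pd j (pd i V) (Fin.tail z) := by
    rw [Fin.sum_univ_succ, D.pd_succ_christoffel_zero_succ_zero hz hε]
    simp only [D.pd_succ_christoffel_succ_succ_succ hz hε, Finset.sum_sub_distrib,
      ← Finset.mul_sum, D.sum_pd_mul_grad hz, Finset.sum_add_distrib (f := fun k => _ * pd j _ _),
      if_true]
    simp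
    ring
  have e3 : ∑ k, ∑ l, christoffel (scaledMetric ε V h a b) k k l z *
      christoffel (scaledMetric ε V h a b) l i.succ j.succ z =
      ∑ k, ∑ l, christoffel h k k l (Fin.tail z) * christoffel h l i j (Fin.tail z)
      + (a - b * n) * ∑ l, pd l V (Fin.tail z) * christoffel h l i j (Fin.tail z)
      - b * ((∑ k, christoffel h k i k (Fin.tail z)) * pd j V (Fin.tail z)
        + (∑ k, christoffel h k j k (Fin.tail z)) * pd i V (Fin.tail z)
        - h (Fin.tail z) i j * ∑ l, (∑ k, christoffel h k k l (Fin.tail z)) *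
          grad V h l (Fin.tail z))
      - b * (a - b * n) * (2 * (pd i V (Fin.tail z) * pd j V (Fin.tail z))
        - h (Fin.tail z) i j * ∑ k, pd k V (Fin.tail z) * grad V h k (Fin.tail z)) := by
    rw [Finset.sum_comm]
    simp only [← Finset.sum_mul]
    rw [Fin.sum_univ_succ, D.christoffel_zero_succ_succ hz hε, mul_zero, zero_add]
    have htr : ∀ l : Fin n, ∑ k, christoffel (scaledMetric ε V h a b) k k l.succ z =
        ∑ k, christoffel h k k l (Fin.tail z) + (a - b * n) * pd l V (Fin.tail z) := by
      intro l
      rw [Fin.sum_univ_succ, D.christoffel_zero_zero_succ hz hε, D.sum_christoffel_trace' hz hε]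
      ring
    have hsymm : ∀ l : Fin n, ∑ k, christoffel h k l k (Fin.tail z) =
        ∑ k, christoffel h k k l (Fin.tail z) :=
      fun l => Finset.sum_congr rfl fun k _ => D.christoffel_symm hz _ _ _
    have t := sum_mul_conformal (fun i => pd i V (Fin.tail z)) (fun k => grad V h k (Fin.tail z))
      (fun i j => h (Fin.tail z) i j) (fun l => ∑ k, christoffel h k k l (Fin.tail z)
        + (a - b * n) * pd l V (Fin.tail z)) i j
    simp only [htr, D.christoffel_succ_succ_succ hz hε, hsymm, mul_sub,
      mul_left_comm _ b, Finset.sum_sub_distrib, ← Finset.mul_sum] at t ⊢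
    rw [sub_eq_iff_eq_add.1 t, Finset.sum_comm (f := fun k l => christoffel h k k l _ * christoffel h l i j _)]
    simp only [add_mul, Finset.sum_add_distrib, ← Finset.sum_mul, mul_assoc, ← Finset.mul_sum]
    ring
  have e4 : ∑ k, ∑ l, christoffel (scaledMetric ε V h a b) k j.succ l z *
      christoffel (scaledMetric ε V h a b) l i.succ k z =
      a ^ 2 * (pd i V (Fin.tail z) * pd j V (Fin.tail z)) +
      ∑ k, ∑ l, (christoffel h k j l (Fin.tail z) * christoffel h l i k (Fin.tail z))
      - b * (2 * ∑ l, pd l V (Fin.tail z) * christoffel h l i j (Fin.tail z)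
        + pd j V (Fin.tail z) * ∑ k, christoffel h k i k (Fin.tail z)
        + pd i V (Fin.tail z) * ∑ k, christoffel h k j k (Fin.tail z)
        - ∑ k, pd k (fun w => h w i j) (Fin.tail z) * grad V h k (Fin.tail z))
      + b ^ 2 * ((n + 2) * (pd i V (Fin.tail z) * pd j V (Fin.tail z))
        - 2 * h (Fin.tail z) i j * ∑ k, pd k V (Fin.tail z) * grad V h k (Fin.tail z)) := by
    rw [Fin.sum_univ_succ]
    simp only [Fin.sum_univ_succ (n := n), D.christoffel_zero_succ_zero hz hε,
      D.christoffel_zero_succ_succ hz hε,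
      D.christoffel_succ_succ_zero hz hε, mul_zero, zero_add, Finset.sum_const_zero, add_zero,
      D.christoffel_succ_succ_succ hz hε]
    rw [sum_sum_sub_mul_sub (fun k i j => christoffel h k i j (Fin.tail z))
      (fun i => pd i V (Fin.tail z)) (fun k => grad V h k (Fin.tail z))
      (fun i j => h (Fin.tail z) i j) (fun i j => (D.h_symm _ hz).apply j i)
      (fun i => D.sum_mul_grad hz i)]
    -- Metric compatibility writes the lowered Christoffel terms as `V^k ∂_k h_ij`, the form in
    -- which they cancel against `e1`.
    have hc : ∑ k, pd k (fun w => h w i j) (Fin.tail z) * grad V h k (Fin.tail z) =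
        ∑ l, h (Fin.tail z) j l * ∑ k, christoffel h l i k (Fin.tail z) * grad V h k (Fin.tail z) +
        ∑ l, h (Fin.tail z) i l *
          ∑ k, christoffel h l j k (Fin.tail z) * grad V h k (Fin.tail z) := by
      simp only [D.pd_h_eq hz, add_mul, Finset.sum_add_distrib, Finset.sum_mul, Finset.mul_sum,
        mul_assoc]
      congr 1 <;> exact Finset.sum_comm
    rw [hc]
    simp only [D.christoffel_symm hz _ j i]
    ring
  simp only [ricci]
  rw [e1, e2, e3, e4, reducedBox]
  set P := pd i V (Fin.tail z) * pd j V (Fin.tail z)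
  linear_combination (-pd j (pd i V) (Fin.tail z) +
    (∑ l, pd l V (Fin.tail z) * christoffel h l i j (Fin.tail z)) +
    b * h (Fin.tail z) i j * (∑ k, pd k V (Fin.tail z) * grad V h k (Fin.tail z))) * hab

end SmoothData
-- Seed and transformed configuration as members of the family.
theorem orthMetric_eq_scaledMetric {n : ℕ} (ε : ℝ) (V : (Fin n → ℝ) → ℝ) (h : TensorField n) :
    orthMetric ε V h = scaledMetric ε V h 1 1 := by
  unfold orthMetric scaledMetric
  norm_num

theorem Seed.transform_zero_g {n : ℕ} (s : Seed n) (p : Params) :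
    (s.transform p 0).g = scaledMetric s.ε s.V s.h p.α (p.α + p.δ) := by
  funext z
  ext i j
  refine Fin.cases ?_ (fun i => ?_) i <;> refine Fin.cases ?_ (fun j => ?_) j <;>
    simp only [Seed.transform, orthMetric, scaledMetric, Matrix.smul_apply, Matrix.of_apply,
      Fin.cons_zero, Fin.cons_succ, Pi.zero_apply, mul_zero, Real.exp_zero, one_smul, smul_eq_mul]
  · ring_nf
  · rw [← mul_assoc, ← Real.exp_add]
    ring_nf

theorem Seed.transform_zero_φ {n : ℕ} (s : Seed n) (p : Params) :
    (s.transform p 0).φ = fun z => p.σ * s.V (Fin.tail z) := by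
  simp [Seed.transform]

theorem Seed.ε_mul_ε {n : ℕ} (s : Seed n) : s.ε * s.ε = 1 := by
  rcases s.ε_sign with h | h <;> simp [h]

theorem Seed.exists_tail_eq {n : ℕ} (s : Seed n) {x : Fin n → ℝ} (hx : x ∈ s.Ω) :
    ∃ z ∈ cylinder s.J s.Ω, Fin.tail z = x := by
  obtain ⟨y, hy⟩ := s.J_nonempty
  exact ⟨Fin.cons y x, ⟨by simpa using hy, by simpa using hx⟩, by simp⟩

/-- A symmetric matrix of rank at most one in dimension at least two is degenerate. -/
theorem eq_zero_of_mul_eq_rank_one {n : ℕ} (hn : 2 ≤ n) {h : Matrix (Fin n) (Fin n) ℝ}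
    (hdet : h.det ≠ 0) {c q : ℝ} {v : Fin n → ℝ} (H : ∀ i j, c * h i j = q * (v i * v j)) :
    c = 0 := by
  by_contra hc
  apply hdet
  have hh : h = Matrix.vecMulVec (fun i => c⁻¹ * q * v i) v := by
    ext i j
    rw [Matrix.vecMulVec_apply]
    field_simp
    rw [mul_comm, H]
    ring
  have : Nontrivial (Fin n) := Fin.nontrivial_iff_two_le.2 hn
  rw [hh, Matrix.det_vecMulVec]

/-! ### Comparison of the two sets of field equations. -/

section equations
variable {n : ℕ} (s : Seed n) {x : Fin n → ℝ}

/-- This is the `dy²` component of the vacuum equation, divided by `ε e^{2V}`. -/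
theorem Seed.exp_mul_reducedBox (hx : x ∈ s.Ω) :
    Real.exp (2 * s.V x) * reducedBox s.V s.h x = -(2 / (dimN n - 2) * s.Λ) := by
  obtain ⟨z, hz, rfl⟩ := s.exists_tail_eq hx
  have h0 := s.vacuum z hz 0 0
  rw [orthMetric_eq_scaledMetric, s.smoothData.ricci_zero_zero hz.2 s.ε_mul_ε 1 1 (by ring),
    scaledMetric_zero_zero] at h0
  have he : s.ε * Real.exp (2 * 1 * s.V (Fin.tail z)) ≠ 0 :=
    mul_ne_zero (left_ne_zero_of_mul_eq_one s.ε_mul_ε) (Real.exp_ne_zero _)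
  have h4 : Real.exp (2 * (1 + 1) * s.V (Fin.tail z)) =
      Real.exp (2 * 1 * s.V (Fin.tail z)) * Real.exp (2 * s.V (Fin.tail z)) := by
    rw [← Real.exp_add]; ring_nf
  rw [h4] at h0
  apply mul_left_cancel₀ he
  linear_combination -h0

theorem Params.DeltaRule.relation {p : Params} (hn : 3 ≤ n) (hp : p.DeltaRule n) :
    p.α - ((n : ℝ) - 2) * (p.α + p.δ) = 3 - n := by
  have hn' : (3 : ℝ) ≤ n := by exact_mod_cast hn
  have : dimN n - 3 ≠ 0 := by simp only [dimN]; linarith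
  unfold Params.DeltaRule at hp
  rw [hp]
  field_simp
  ring

variable {κ : ℝ} {p : Params}

/-- The `dy²` component for the transform has no scalar gradient term, since `φ` does not depend on
`y`. -/
theorem Seed.alpha_mul_reducedBox (hn : 3 ≤ n) (hp : p.DeltaRule n)
    (hs : (s.transform p 0).IsSolution κ) (hx : x ∈ s.Ω) :
    p.α * (Real.exp (2 * (p.α + p.δ) * s.V x) * reducedBox s.V s.h x) =
      -(2 / (dimN n - 2) * κ * (s.transform p 0).W (p.σ * s.V x)) := by
  obtain ⟨z, hz, rfl⟩ := s.exists_tail_eq hx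
  have hV := (s.smoothData.V_at hz.2).differentiableAt (by simp)
  have h0 := (hs z hz).1 0 0
  rw [s.transform_zero_g, s.transform_zero_φ,
    s.smoothData.ricci_zero_zero hz.2 s.ε_mul_ε _ _ (hp.relation hn), scaledMetric_zero_zero,
    pd_zero_comp_tail (f := fun x => p.σ * s.V x) (by fun_prop)] at h0
  have he : s.ε * Real.exp (2 * p.α * s.V (Fin.tail z)) ≠ 0 :=
    mul_ne_zero (left_ne_zero_of_mul_eq_one s.ε_mul_ε) (Real.exp_ne_zero _)
  have h4 : Real.exp (2 * (p.α + (p.α + p.δ)) * s.V (Fin.tail z)) =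
      Real.exp (2 * p.α * s.V (Fin.tail z)) *
        Real.exp (2 * (p.α + p.δ) * s.V (Fin.tail z)) := by
    rw [← Real.exp_add]; ring_nf
  rw [h4] at h0
  apply mul_left_cancel₀ he
  linear_combination -h0

/-- The difference between the spatial field equations of the transformed configuration and
those of the seed. -/
theorem Seed.spatial_difference (hn : 3 ≤ n) (hp : p.DeltaRule n)
    (hs : (s.transform p 0).IsSolution κ) (hx : x ∈ s.Ω) (i j : Fin n) :
    2 / (dimN n - 2) * (κ * (Real.exp (-(2 * (p.α + p.δ)) * s.V x) *
      (s.transform p 0).W (p.σ * s.V x)) - s.Λ * (Real.exp (-(2 * 1) * s.V x))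
        * (2 - (p.α + p.δ))) * s.h x i j =
      ((n - 2) * (p.α + p.δ) ^ 2 - 2 * p.α * (p.α + p.δ) - p.α ^ 2 - (n - 5) - κ * p.σ ^ 2) *
        (pd i s.V x * pd j s.V x) := by
  have hE := s.exp_mul_reducedBox hx
  obtain ⟨z, hz, rfl⟩ := s.exists_tail_eq hx
  have hV := (s.smoothData.V_at hz.2).differentiableAt (by simp)
  have h1 := (hs z hz).1 i.succ j.succ
  have h2 := s.vacuum z hz i.succ j.succ
  rw [orthMetric_eq_scaledMetric, s.smoothData.ricci_succ_succ hz.2 s.ε_mul_ε 1 1 (by ring),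
    scaledMetric_succ_succ] at h2
  rw [s.transform_zero_g, s.transform_zero_φ,
    s.smoothData.ricci_succ_succ hz.2 s.ε_mul_ε _ _ (hp.relation hn), scaledMetric_succ_succ,
    pd_succ_comp_tail (f := fun x => p.σ * s.V x) (by fun_prop),
    pd_succ_comp_tail (f := fun x => p.σ * s.V x) (by fun_prop), pd_const_mul hV,
    pd_const_mul hV] at h1
  have h4 : Real.exp (-(2 * 1) * s.V (Fin.tail z)) * Real.exp (2 * s.V (Fin.tail z)) = 1 := by
    rw [← Real.exp_add]; ring_nf; simp
  -- The seed's `dy²` equation eliminates `reducedBox` from both spatial equations; in their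
  -- difference the Ricci tensor of `h` and the Hessian of `V` cancel.
  have hR : reducedBox s.V s.h (Fin.tail z) = Real.exp (-(2 * 1) * s.V (Fin.tail z)) *
      -(2 / (dimN n - 2) * s.Λ) := by
    rw [← hE, ← mul_assoc, h4, one_mul]
  rw [hR] at h1 h2
  linear_combination h2 - h1

/-- Eliminating `reducedBox` between the two `dy²` equations gives the first relation. The second
follows by inserting it into the vanishing coefficient of `h_ij` in `spatial_difference`; all
exponentials then reduce to `e^{-2V}`. -/
theorem Seed.lambda_relations (hn : 3 ≤ n) (hp : p.DeltaRule n)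
    (hs : (s.transform p 0).IsSolution κ) (hx : x ∈ s.Ω) :
    κ * (s.transform p 0).W (p.σ * s.V x) = p.α * s.Λ *
      Real.exp (2 * (p.α + p.δ - 1) * s.V x) ∧
    s.Λ * (2 - p.α - (p.α + p.δ)) = 0 := by
  have hn' : (3 : ℝ) ≤ n := by exact_mod_cast hn
  have hd : 2 / (dimN n - 2) ≠ 0 := by
    simp only [dimN]
    exact div_ne_zero two_ne_zero (by linarith)
  have h1 := s.exp_mul_reducedBox hx
  have h2 := s.alpha_mul_reducedBox hn hp hs hx
  have e1 : Real.exp (2 * (p.α + p.δ) * s.V x) =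
      Real.exp (2 * (p.α + p.δ - 1) * s.V x) * Real.exp (2 * s.V x) := by
    rw [← Real.exp_add]; ring_nf
  have e2 : Real.exp (-(2 * (p.α + p.δ)) * s.V x) * Real.exp (2 * (p.α + p.δ - 1) * s.V x) =
      Real.exp (-(2 * 1) * s.V x) := by
    rw [← Real.exp_add]; ring_nf
  have hA : κ * (s.transform p 0).W (p.σ * s.V x) = p.α * s.Λ *
      Real.exp (2 * (p.α + p.δ - 1) * s.V x) := by
    apply mul_left_cancel₀ hd
    rw [e1] at h2
    linear_combination h2 - p.α * Real.exp (2 * (p.α + p.δ - 1) * s.V x) * h1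
  refine ⟨hA, ?_⟩
  have h3 := eq_zero_of_mul_eq_rank_one (by omega) (s.h_nondeg x hx)
    (s.spatial_difference hn hp hs hx)
  have h4 := (mul_eq_zero.1 h3).resolve_left hd
  apply mul_left_cancel₀ (Real.exp_ne_zero (-(2 * 1) * s.V x))
  linear_combination -h4 + Real.exp (-(2 * (p.α + p.δ)) * s.V x) * hA + p.α * s.Λ * e2

theorem Params.DeltaRule.alpha_eq_one (hn : 3 ≤ n) (hp : p.DeltaRule n)
    (h : 2 - p.α - (p.α + p.δ) = 0) : p.α = 1 ∧ p.δ = 0 := by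
  have hn' : (3 : ℝ) ≤ n := by exact_mod_cast hn
  have hr := hp.relation hn
  have hα : p.α = 1 := by
    -- Eliminating `α + δ` from the two linear equations leaves one equation for `α`.
    have : ((n : ℝ) - 1) * (p.α - 1) = 0 := by linear_combination hr - ((n : ℝ) - 2) * h
    rcases mul_eq_zero.1 this with h | h <;> linarith
  exact ⟨hα, by linarith⟩

theorem Seed.W₀_eq_zero (hn : 3 ≤ n) (hκ : 0 < κ) (hp : p.DeltaRule n)
    (hs : (s.transform p 0).IsSolution κ) (hΛ : s.Λ = 0) : p.W₀ = 0 := by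
  obtain ⟨x, hx⟩ := s.Ω_nonempty
  have h := (s.lambda_relations hn hp hs hx).1
  simp only [hΛ, Seed.transform, mul_zero, zero_mul, mul_eq_zero, hκ.ne', Real.exp_ne_zero,
    or_false, false_or] at h
  exact h

/-- A seed with non-zero cosmological constant is not changed by the transformation. -/
theorem Seed.rigidity (hn : 3 ≤ n) (hp : p.DeltaRule n)
    (hs : (s.transform p 0).IsSolution κ) (hΛ : s.Λ ≠ 0) : p.α = 1 ∧ p.δ = 0 := by
  obtain ⟨x, hx⟩ := s.Ω_nonempty
  exact hp.alpha_eq_one hn ((mul_eq_zero.1 (s.lambda_relations hn hp hs hx).2).resolve_left hΛ)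

/-- Every term of `reducedBox` contains the gradient of `V` or its derivative, so the seed's `dy²`
equation reduces to `Λ = 0`. -/
theorem Seed.Λ_eq_zero_of_pd_eq_zero (hn : 3 ≤ n) (h : ∀ x ∈ s.Ω, ∀ i, pd i s.V x = 0) :
    s.Λ = 0 := by
  have hn' : (3 : ℝ) ≤ n := by exact_mod_cast hn
  obtain ⟨x, hx⟩ := s.Ω_nonempty
  have hg : ∀ x ∈ s.Ω, ∀ k, grad s.V s.h k x = 0 := fun x hx k => by simp [grad, h x hx]
  have hd : ∀ k, pd k (grad s.V s.h k) x = 0 := fun k => by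
    rw [pd_congr (Filter.eventually_of_mem (s.Ω_open.mem_nhds hx) fun w hw => hg w hw k), pd_const]
  have h1 := s.exp_mul_reducedBox hx
  simp only [reducedBox, hd, hg x hx, mul_zero, Finset.sum_const_zero, add_zero, sub_zero] at h1
  have : dimN n - 2 ≠ 0 := by simp only [dimN]; linarith
  field_simp at h1
  linarith

theorem Seed.sigma_mul_pd_eq_zero (hn : 3 ≤ n) (hκ : 0 < κ) (hp : p.DeltaRule n)
    (hs : (s.transform p 0).IsSolution κ) (hΛ : s.Λ ≠ 0) (hx : x ∈ s.Ω) (i : Fin n) :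
    p.σ * pd i s.V x = 0 := by
  obtain ⟨hα, hδ⟩ := s.rigidity hn hp hs hΛ
  have h1 := s.spatial_difference hn hp hs hx i i
  have h2 := eq_zero_of_mul_eq_rank_one (by omega) (s.h_nondeg x hx)
    (s.spatial_difference hn hp hs hx)
  rw [h2, hα, hδ] at h1
  -- At `α = 1`, `δ = 0` the geometric coefficient `(n - 2) - 2 - 1 - (n - 5)` is zero, so only `-κ
  -- σ²` remains.
  have : κ * (p.σ * pd i s.V x) ^ 2 = 0 := by linear_combination h1
  simpa [hκ.ne'] using this

/-- The hypotheses on `k` and `ρ` exclude a constant scalar field with a non-zero potential. -/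
theorem Seed.Λ_eq_zero_of_admissible (hn : 3 ≤ n) (hκ : 0 < κ) (hp : p.Admissible n κ s.Λ)
    (hs : (s.transform p 0).IsSolution κ) : s.Λ = 0 := by
  by_contra hΛ
  have hn' : (3 : ℝ) ≤ n := by exact_mod_cast hn
  obtain ⟨hα, hδ⟩ := s.rigidity hn hp.delta_rule hs hΛ
  have hσ : p.σ = 0 := by
    have := hp.sigma_rule
    simpa [Params.SigmaRule, hα] using this
  obtain ⟨x, hx⟩ := s.Ω_nonempty
  have hW := (s.lambda_relations hn hp.delta_rule hs hx).1
  -- At `α = 1`, `δ = 0` the relation `hW` reads `κ W = Λ`, so the potential cannot vanish.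
  have hW₀ : p.W₀ ≠ 0 := by
    intro h0
    simp [Seed.transform, h0, hα, hΛ] at hW
  obtain ⟨z, hz, rfl⟩ := s.exists_tail_eq hx
  have hbox := (hs z hz).2
  have hφ : (s.transform p 0).φ = fun _ => 0 := by rw [s.transform_zero_φ, hσ]; simp
  have hderiv : deriv (s.transform p 0).W 0 = p.W₀ * (-2 * p.k) := by
    have h1 : HasDerivAt (fun t : ℝ => -2 * p.k * t) (-2 * p.k) 0 := by
      simpa using (hasDerivAt_id (0 : ℝ)).const_mul (-2 * p.k)
    refine (h1.exp.const_mul p.W₀).deriv.trans ?_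
    simp
  rw [hφ, hderiv] at hbox
  simp only [box, pd_const, mul_zero, Finset.sum_const_zero, sub_zero, zero_sub] at hbox
  -- With `φ = 0` the scalar equation is `W'(0) = -2 k W₀ = 0`.
  have hk : p.k = 0 := by simpa [hW₀] using hbox
  have hρ := hp.k_rule hW₀
  have hd : dimN n - 2 ≠ 0 := by simp only [dimN]; linarith
  rw [hk, eq_comm] at hρ
  simp [hκ.ne', hd, hp.rho_ne_zero hΛ] at hρ

end equations
end EinsteinScalar

end

open EinsteinScalar in
theorem corollary1 (n : ℕ) (hn : 3 ≤ n) (κ : ℝ) (hκ : 0 < κ) :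
    -- the class `S_N^Λ` is empty
    classSLambda n κ = ∅ ∧
    -- `W₀ = 0` for the entire class `S_N`
    (∀ (s : Seed n) (p : Params), p.Admissible n κ s.Λ →
      (s.transform p 0).IsSolution κ → p.W₀ = 0) ∧
    -- no solution of class `S_N` has a potential term
    (∀ c ∈ classS n κ, ∀ t : ℝ, c.W t = 0) ∧
    -- for a non-constant scalar field this only needs the relation between `δ` and `α`
    (∀ (s : Seed n) (p : Params), p.DeltaRule n →
      (s.transform p 0).IsSolution κ →
      (¬ ∃ t : ℝ, ∀ z ∈ (s.transform p 0).dom, (s.transform p 0).φ z = t) →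
      s.Λ = 0 ∧ p.W₀ = 0) := by
  have h2 : ∀ (s : Seed n) (p : Params), p.Admissible n κ s.Λ →
      (s.transform p 0).IsSolution κ → p.W₀ = 0 := fun s p hp hs =>
    s.W₀_eq_zero hn hκ hp.delta_rule hs (s.Λ_eq_zero_of_admissible hn hκ hp hs)
  refine ⟨?_, h2, ?_, ?_⟩
  · refine Set.eq_empty_of_forall_notMem ?_
    rintro c ⟨Λ, hΛ, s, p, rfl, hp, rfl, hs⟩
    exact hΛ (s.Λ_eq_zero_of_admissible hn hκ hp hs)
  · rintro c ⟨Λ, s, p, rfl, hp, rfl, hs⟩ t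
    simp [Seed.transform, h2 s p hp hs]
  · intro s p hp hs hφ
    have hΛ : s.Λ = 0 := by
      by_contra hΛ
      -- Nonconstancy of `φ` is used only through `σ ≠ 0`; the contradiction comes from the
      -- pointwise vanishing of `∂V`, so no connectedness of the domain is needed.
      have hσ : p.σ ≠ 0 := by
        intro hσ
        exact hφ ⟨0, fun z _ => by simp [s.transform_zero_φ, hσ]⟩
      exact hΛ (s.Λ_eq_zero_of_pd_eq_zero hn fun x hx i =>
        (mul_eq_zero.1 (s.sigma_mul_pd_eq_zero hn hκ hp hs hΛ hx i)).resolve_left hσ)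
    exact ⟨hΛ, s.W₀_eq_zero hn hκ hp hs hΛ⟩
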